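/- Let $d\ge 2$, $0\le r_0<r_1\le\infty$ and $A(r_0,r_1)=\{x\in\mathbb{R}^d : r_0<|x|<r_1\}$. For each $k\in\mathbb{N}_0$ let $Y_{k,l}$, $l=1,\dots,a_k$, be a basis of the ($a_k$-dimensional) complex vector space of harmonic homogeneous polynomials of degree $k$ in $d$ variables which is orthonormal with respect to $\langle g,h\rangle=\int_{\mathbb{S}^{d-1}}g(\theta)\overline{h(\theta)}\,d\theta$, where $d\theta$ is the surface measure on the unit sphere $\mathbb{S}^{d-1}$. Let $\tau\ge 0$ and let $f:A(r_0,r_1)\to\mathbb{C}$ be polyharmonic of infinite order and type $\tau$, that is, $f$ is $C^\infty$ and for every compact $K\subset A(r_0,r_1)$ and every $\varepsilon>0$ there is a constant $C_{K,\varepsilon}>0$ such that $$\max_{x\in K}|\Delta^p f(x)|\le C_{K,\varepsilon}\,(2p)!\,(\tau+\varepsilon)^{2p}\qquad\text{for all }p\in\mathbb{N}_0 .$$ For $v\in(\log r_0,\log r_1)$ (with $\log 0=-\infty$, $\log\infty=\infty$) put $$\widetilde f_{k,l}(v)=f_{k,l}(e^v),\qquad f_{k,l}(r)=\int_{\mathbb{S}^{d-1}}f(r\theta)\overline{Y_{k,l}(\theta)}\,d\theta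 ,$$ and, with $\lambda_{2j}=k+2j$ and $\lambda_{2j+1}=-k-d+2+2j$ for $j\in\mathbb{N}_0$, let $$D^{(n)}g=\Big(\frac{d}{dv}-\lambda_0\Big)\cdots\Big(\frac{d}{dv}-\lambda_{n-1}\Big)g,\qquad D^{(0)}g=g .$$ Then every $\widetilde f_{k,l}$ is $C^\infty$ on $(\log r_0,\log r_1)$, and for every $v_0\in(\log r_0,\log r_1)$ and every $\varepsilon>0$ there is a constant $C>0$ such that $$\big|D^{(n)}\widetilde f_{k,l}(v_0)\big|\le C\cdot n!\cdot\big[e^{v_0}(\tau+\varepsilon)\big]^n$$ for all $n\in\mathbb{N}_0$, all $k\in\mathbb{N}_0$ and all $l=1,\dots,a_k$. -/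

import Mathlib

open MeasureTheory
open scoped ENNReal ContDiff InnerProductSpace ComplexConjugate

noncomputable section

/-- The annular region `A(r₀, r₁) = {x ∈ ℝᵈ : r₀ < |x| < r₁}`, where `0 ≤ r₀` and `r₁ ≤ ∞`. -/
def annulus (d : ℕ) (r₀ r₁ : ℝ≥0∞) : Set (EuclideanSpace ℝ (Fin d)) :=
  {x | r₀ < ENNReal.ofReal ‖x‖ ∧ ENNReal.ofReal ‖x‖ < r₁}

/-- The interval `(log r₀, log r₁)`, where `log 0 = -∞` and `log ∞ = ∞`. -/
def logInterval (r₀ r₁ : ℝ≥0∞) : Set ℝ :=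
  {v | ENNReal.log r₀ < (v : EReal) ∧ (v : EReal) < ENNReal.log r₁}

/-- `f` is polyharmonic of infinite order and type `τ` on the (open) set `G`: it is smooth on `G`
and `max_K |Δᵖ f| ≤ C_{K,ε} (2p)! (τ + ε)^{2p}` for all compact `K ⊆ G`, `ε > 0` and all `p`. -/
def PolyharmonicOfInfiniteOrder {d : ℕ} (τ : ℝ) (G : Set (EuclideanSpace ℝ (Fin d)))
    (f : EuclideanSpace ℝ (Fin d) → ℂ) : Prop :=
  ContDiffOn ℝ ∞ f G ∧
    ∀ K ⊆ G, IsCompact K → ∀ ε : ℝ, 0 < ε → ∃ C : ℝ, 0 < C ∧ ∀ p : ℕ, ∀ x ∈ K,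
      ‖((fun g : EuclideanSpace ℝ (Fin d) → ℂ => Laplacian.laplacian g)^[p] f) x‖ ≤ C * (2 * p).factorial * (τ + ε) ^ (2 * p)

/-- The Laplacian `∑ᵢ ∂²/∂xᵢ²` on polynomials in `d` variables with complex coefficients. -/
def polyLaplacian (d : ℕ) : MvPolynomial (Fin d) ℂ →ₗ[ℂ] MvPolynomial (Fin d) ℂ :=
  ∑ i : Fin d, (MvPolynomial.pderiv i).toLinearMap ∘ₗ (MvPolynomial.pderiv i).toLinearMap

/-- The space of harmonic homogeneous polynomials of degree `k` in `d` variables. -/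
def harmonicPolys (d k : ℕ) : Submodule ℂ (MvPolynomial (Fin d) ℂ) :=
  MvPolynomial.homogeneousSubmodule (Fin d) ℂ k ⊓ LinearMap.ker (polyLaplacian d)

/-- The dimension `a_k` of the space of harmonic homogeneous polynomials of degree `k`. -/
def harmonicDim (d k : ℕ) : ℕ := Module.finrank ℂ (harmonicPolys d k)

/-- The value of a polynomial at a point of `ℝᵈ`. -/
def polyVal {d : ℕ} (P : MvPolynomial (Fin d) ℂ) (x : EuclideanSpace ℝ (Fin d)) : ℂ :=
  MvPolynomial.eval (fun i => (x i : ℂ)) P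

/-- The surface measure `dθ` on the unit sphere of `ℝᵈ`; its total mass is `d` times the volume
of the unit ball. -/
def sphereMeasure (d : ℕ) : Measure (Metric.sphere (0 : EuclideanSpace ℝ (Fin d)) 1) :=
  (volume : Measure (EuclideanSpace ℝ (Fin d))).toSphere

/-- The scalar product `⟨f, g⟩ = ∫ f(θ) conj(g(θ)) dθ` over the unit sphere. -/
def sphereInner {d : ℕ} (f g : EuclideanSpace ℝ (Fin d) → ℂ) : ℂ :=
  ∫ θ, f θ * conj (g θ) ∂(sphereMeasure d)

/-- A choice, for every degree `k`, of a basis `Y_{k,l}`, `l = 1, …, a_k`, of the space of harmonic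
homogeneous polynomials of degree `k` that is orthonormal for the scalar product on the sphere. -/
structure SphericalHarmonicBasis (d : ℕ) where
  Y : (k : ℕ) → Module.Basis (Fin (harmonicDim d k)) ℂ (harmonicPolys d k)
  orthonormal : ∀ k l m,
    sphereInner (polyVal (Y k l : MvPolynomial (Fin d) ℂ))
      (polyVal (Y k m : MvPolynomial (Fin d) ℂ)) = if l = m then 1 else 0

/-- The Fourier-Laplace coefficient `f_{k,l}(r) = ∫ f(rθ) conj(Y_{k,l}(θ)) dθ`. -/
def fourierLaplaceCoeff {d : ℕ} (B : SphericalHarmonicBasis d)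
    (f : EuclideanSpace ℝ (Fin d) → ℂ) (k : ℕ) (l : Fin (harmonicDim d k)) (r : ℝ) : ℂ :=
  ∫ θ : Metric.sphere (0 : EuclideanSpace ℝ (Fin d)) 1,
    f (r • (θ : EuclideanSpace ℝ (Fin d))) *
      conj (polyVal (B.Y k l : MvPolynomial (Fin d) ℂ) (θ : EuclideanSpace ℝ (Fin d)))
    ∂(sphereMeasure d)

/-- `f̃_{k,l}(v) = f_{k,l}(e^v)`. -/
def logFourierLaplaceCoeff {d : ℕ} (B : SphericalHarmonicBasis d)
    (f : EuclideanSpace ℝ (Fin d) → ℂ) (k : ℕ) (l : Fin (harmonicDim d k)) (v : ℝ) : ℂ :=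
  fourierLaplaceCoeff B f k l (Real.exp v)

/-- The exponents `λ_{2j} = k + 2j` and `λ_{2j+1} = -k - d + 2 + 2j`
(here `2j = 2 * (n / 2)` with the quotient of natural numbers). -/
def exponent (d k n : ℕ) : ℝ :=
  if n % 2 = 0 then (k : ℝ) + (2 * (n / 2) : ℕ)
  else -(k : ℝ) - (d : ℝ) + 2 + (2 * (n / 2) : ℕ)

/-- `D^{(n)} g = (d/dv - λ₀) ⋯ (d/dv - λ_{n-1}) g`. The factors commute on smooth functions;
the factor with `λ_n` is applied last when passing from `n` to `n + 1`. -/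
def genDeriv (lam : ℕ → ℝ) (g : ℝ → ℂ) : ℕ → ℝ → ℂ
  | 0 => g
  | n + 1 => fun v => deriv (genDeriv lam g n) v - (lam n : ℂ) * genDeriv lam g n v

end

/-!
The fields `A x` of skew-adjoint `A` generate rotations, which preserve the surface measure, so
integration by parts on the sphere has no boundary terms. Writing the angular part of the Laplacian
as a sum of squares of such fields makes it symmetric, and a spherical harmonic of degree `k` is an
eigenfunction of it. Hence the coefficients `R f` of `f` with respect to a spherical harmonic
satisfy `(d/dv - k) (d/dv + k + d - 2) R f = e^(2v) R (Δ f)`. The factors `e^(2v)` shift the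
exponents by `2`, so `D^(2p) R f = e^(2pv) R (Δ^p f)`, and the even orders inherit the growth of
`Δ^p f`.

For the odd orders one has to bound `(d/dv - k) R f` by `R f` and `R (Δ f)` uniformly in `k`. The
first order system for `R f` and `(d/dv - k) R f` gives this, since its second equation has the
damping term `-(k + d - 2)`, which dominates `k` because `d ≥ 2`.
-/

open Set Filter Topology Module

theorem hasDerivAt_integral_of_continuousOn_prod {X F : Type*} [TopologicalSpace X]
    [CompactSpace X] [MeasurableSpace X] [OpensMeasurableSpace X] [NormedAddCommGroup F]
    [NormedSpace ℝ F] (μ : Measure X) [IsFiniteMeasure μ] {f f' : ℝ → X → F} {U : Set ℝ}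
    (hU : IsOpen U) {t₀ : ℝ} (ht₀ : t₀ ∈ U) (hf : ContinuousOn (Function.uncurry f) (U ×ˢ univ))
    (hf' : ContinuousOn (Function.uncurry f') (U ×ˢ univ))
    (hderiv : ∀ t ∈ U, ∀ x, HasDerivAt (fun s => f s x) (f' t x) t) :
    HasDerivAt (fun t => ∫ x, f t x ∂μ) (∫ x, f' t₀ x ∂μ) t₀ := by
  obtain ⟨δ, hδ, hball⟩ := Metric.nhds_basis_closedBall.mem_iff.1 (hU.mem_nhds ht₀)
  have integrable_slice {h : ℝ → X → F} (hh : ContinuousOn (Function.uncurry h) (U ×ˢ univ))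
      {t : ℝ} (ht : t ∈ U) : Integrable (h t) μ :=
    (hh.comp_continuous (f := fun x => (t, x)) (by fun_prop)
      fun x => ⟨ht, mem_univ x⟩).integrable_of_hasCompactSupport (.of_compactSpace _)
  obtain ⟨C, hC⟩ := ((isCompact_closedBall t₀ δ).prod isCompact_univ).exists_bound_of_continuousOn
    (hf'.mono (prod_mono hball subset_rfl))
  refine (hasDerivAt_integral_of_dominated_loc_of_deriv_le (bound := fun _ => C)
    (Metric.closedBall_mem_nhds t₀ hδ) ?_ (integrable_slice hf ht₀)
    (integrable_slice hf' ht₀).aestronglyMeasurable ?_ (integrable_const C) ?_).2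
  · filter_upwards [hU.mem_nhds ht₀] with t ht using (integrable_slice hf ht).aestronglyMeasurable
  · exact .of_forall fun x t ht => hC (t, x) ⟨ht, mem_univ x⟩
  · exact .of_forall fun x t ht => hderiv t (hball ht) x

section LinDeriv

variable {E F : Type*} [NormedAddCommGroup E] [NormedSpace ℝ E] [NormedAddCommGroup F]
  [NormedSpace ℝ F]

/-- The derivative of `f` along the linear vector field `x ↦ A x`. -/
noncomputable def linDeriv (A : E →L[ℝ] E) (f : E → F) (x : E) : F :=
  fderiv ℝ f x (A x)

/-- The Euler operator `∑ xᵢ ∂/∂xᵢ`: in the coordinates `x = e^v θ` with `|θ| = 1` it is `d/dv`. -/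
noncomputable abbrev eulerDeriv (f : E → F) : E → F :=
  linDeriv (.id ℝ E) f

theorem contDiffOn_linDeriv {A : E →L[ℝ] E} {f : E → F} {G : Set E} {m n : WithTop ℕ∞}
    (hG : IsOpen G) (hf : ContDiffOn ℝ n f G) (hmn : m + 1 ≤ n) :
    ContDiffOn ℝ m (linDeriv A f) G :=
  (hf.fderiv_of_isOpen hG hmn).clm_apply A.contDiff.contDiffOn

theorem contDiff_linDeriv {A : E →L[ℝ] E} {f : E → F} {m n : WithTop ℕ∞}
    (hf : ContDiff ℝ n f) (hmn : m + 1 ≤ n) : ContDiff ℝ m (linDeriv A f) :=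
  (hf.fderiv_right hmn).clm_apply A.contDiff

theorem linDeriv_linDeriv {A : E →L[ℝ] E} {f : E → F} {x : E} (hf : ContDiffAt ℝ 2 f x) :
    linDeriv A (linDeriv A f) x =
      fderiv ℝ (fderiv ℝ f) x (A x) (A x) + fderiv ℝ f x (A (A x)) := by
  have hf' : DifferentiableAt ℝ (fderiv ℝ f) x :=
    (hf.fderiv_right (m := 1) (by norm_num)).differentiableAt (by simp)
  have hlin : HasFDerivAt (linDeriv A f) _ x := hf'.hasFDerivAt.clm_apply A.hasFDerivAt
  rw [linDeriv, hlin.fderiv]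
  simp [add_comm]

theorem linDeriv_comp_smul (A : E →L[ℝ] E) (f : E → F) (c : ℝ) (x : E) :
    linDeriv A (fun y => f (c • y)) x = linDeriv A f (c • x) := by
  simp [linDeriv, fderiv_comp_smul]

theorem linDeriv_mul (A : E →L[ℝ] E) {f g : E → ℂ} {x : E} (hf : DifferentiableAt ℝ f x)
    (hg : DifferentiableAt ℝ g x) :
    linDeriv A (fun y => f y * g y) x = linDeriv A f x * g x + f x * linDeriv A g x := by
  simp [linDeriv, fderiv_fun_mul hf hg]
  ring

end LinDeriv

section SphereRotation

variable {E : Type*} [NormedAddCommGroup E] [NormedSpace ℝ E]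

/-- The self-map of the unit sphere induced by a linear isometry of the ambient space. -/
def sphereMap (e : E ≃ₗᵢ[ℝ] E) (θ : Metric.sphere (0 : E) 1) : Metric.sphere (0 : E) 1 :=
  ⟨e θ, by simp⟩

theorem sphereMap_symm_sphereMap (e : E ≃ₗᵢ[ℝ] E) (θ : Metric.sphere (0 : E) 1) :
    sphereMap e (sphereMap e.symm θ) = θ :=
  Subtype.ext (e.apply_symm_apply θ)

theorem continuous_sphereMap (e : E ≃ₗᵢ[ℝ] E) : Continuous (sphereMap e) :=
  (e.continuous.comp continuous_subtype_val).subtype_mk _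

variable [MeasurableSpace E] [BorelSpace E] {μ : Measure E}

open scoped Pointwise in
theorem measurePreserving_sphereMap {e : E ≃ₗᵢ[ℝ] E} (he : MeasurePreserving e μ μ) :
    MeasurePreserving (sphereMap e) μ.toSphere μ.toSphere := by
  have hmeas : Measurable (sphereMap e) := (continuous_sphereMap e).measurable
  refine ⟨hmeas, Measure.ext fun s hs => ?_⟩
  have hcone : Ioo (0 : ℝ) 1 • (Subtype.val '' (sphereMap e ⁻¹' s)) =
      e ⁻¹' (Ioo (0 : ℝ) 1 • (Subtype.val '' s)) := by
    ext x
    simp only [Set.mem_smul, mem_image, mem_preimage]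
    constructor
    · rintro ⟨r, hr, _, ⟨θ, hθ, rfl⟩, rfl⟩
      exact ⟨r, hr, _, ⟨_, hθ, rfl⟩, by simp [sphereMap]⟩
    · rintro ⟨r, hr, _, ⟨θ, hθ, rfl⟩, hx⟩
      refine ⟨r, hr, _, ⟨sphereMap e.symm θ, by rwa [sphereMap_symm_sphereMap], rfl⟩, ?_⟩
      exact e.injective (by simpa [sphereMap] using hx)
  rw [Measure.map_apply hmeas hs, μ.toSphere_apply' (hmeas hs), μ.toSphere_apply' hs, hcone,
    he.measure_preimage_emb e.toHomeomorph.measurableEmbedding]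

end SphereRotation

section RotationFields

variable {E F : Type*} [NormedAddCommGroup E] [InnerProductSpace ℝ E] [FiniteDimensional ℝ E]
  [NormedAddCommGroup F] [NormedSpace ℝ F] {A : E →L[ℝ] E}

/-- The one-parameter group of isometries `exp (t A)` generated by a skew-adjoint operator `A`. -/
noncomputable def expIsometry (hA : A ∈ skewAdjoint (E →L[ℝ] E)) (t : ℝ) : E ≃ₗᵢ[ℝ] E :=
  Unitary.linearIsometryEquiv ⟨NormedSpace.exp (t • A),
    let +nondep : NormedAlgebra ℚ (E →L[ℝ] E) := .restrictScalars ℚ ℝ _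
    NormedSpace.exp_mem_unitary_of_mem_skewAdjoint (skewAdjoint.smul_mem t hA)⟩

theorem expIsometry_apply (hA : A ∈ skewAdjoint (E →L[ℝ] E)) (t : ℝ) (x : E) :
    expIsometry hA t x = NormedSpace.exp (t • A) x := rfl

theorem expIsometry_zero_apply (hA : A ∈ skewAdjoint (E →L[ℝ] E)) (x : E) :
    expIsometry hA 0 x = x := by
  rw [expIsometry_apply, zero_smul ℝ A, NormedSpace.exp_zero, one_apply_eq_self]

theorem hasDerivAt_expIsometry_apply (hA : A ∈ skewAdjoint (E →L[ℝ] E)) (x : E) (t : ℝ) :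
    HasDerivAt (fun t => expIsometry hA t x) (A (expIsometry hA t x)) t :=
  ((hasDerivAt_exp_smul_const' A t).clm_apply (hasDerivAt_const t x)).congr_deriv
    (by simp [expIsometry_apply])

theorem continuous_expIsometry_apply_sphere (hA : A ∈ skewAdjoint (E →L[ℝ] E)) :
    Continuous fun p : ℝ × Metric.sphere (0 : E) 1 => expIsometry hA p.1 p.2 := by
  have hexp : Continuous fun t : ℝ => NormedSpace.exp (t • A) :=
    continuous_iff_continuousAt.2 fun t => (hasDerivAt_exp_smul_const' A t).continuousAt
  exact (hexp.comp continuous_fst).clm_apply (continuous_subtype_val.comp continuous_snd)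

variable [MeasurableSpace E] [BorelSpace E]

/- The flow of `A` preserves the surface measure, so `∫ h (exp (t A) θ) dθ` is constant in `t`;
the integral below is its derivative at `t = 0`. -/
theorem integral_linDeriv_eq_zero (hA : A ∈ skewAdjoint (E →L[ℝ] E)) {h : E → F} {G : Set E}
    (hG : IsOpen G) (hsub : Metric.sphere 0 1 ⊆ G) (hh : ContDiffOn ℝ 1 h G) :
    ∫ θ : Metric.sphere (0 : E) 1, linDeriv A h θ ∂volume.toSphere = 0 := by
  have hmem (p : ℝ × Metric.sphere (0 : E) 1) : expIsometry hA p.1 p.2 ∈ G := hsub (by simp)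
  have hcont {u : E → F} (hu : ContinuousOn u G) :
      Continuous fun p : ℝ × Metric.sphere (0 : E) 1 => u (expIsometry hA p.1 p.2) :=
    hu.comp_continuous (continuous_expIsometry_apply_sphere hA) hmem
  have hderiv := hasDerivAt_integral_of_continuousOn_prod (volume : Measure E).toSphere
    (f := fun t θ => h (expIsometry hA t θ)) (f' := fun t θ => linDeriv A h (expIsometry hA t θ))
    isOpen_univ (mem_univ (0 : ℝ)) (hcont hh.continuousOn).continuousOn
    (hcont (contDiffOn_linDeriv hG hh (m := 0) (by simp)).continuousOn).continuousOn
    fun t _ θ => ((hh.differentiableOn (by simp)).differentiableAt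
      (hG.mem_nhds (hmem (t, θ)))).hasFDerivAt.comp_hasDerivAt t
        (hasDerivAt_expIsometry_apply hA θ t)
  have hconst (t : ℝ) : ∫ θ : Metric.sphere (0 : E) 1, h (expIsometry hA t θ) ∂volume.toSphere =
      ∫ θ : Metric.sphere (0 : E) 1, h θ ∂volume.toSphere := by
    have hmp := measurePreserving_sphereMap (expIsometry hA t).measurePreserving
    have hhc : Continuous fun θ : Metric.sphere (0 : E) 1 => h θ :=
      hh.continuousOn.comp_continuous continuous_subtype_val fun θ => hsub θ.2
    have hmap := integral_map hmp.aemeasurable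
      (by simpa only [hmp.map_eq] using
        (hhc.integrable_of_hasCompactSupport (.of_compactSpace _)).aestronglyMeasurable)
    rw [hmp.map_eq] at hmap
    exact hmap.symm
  simp only [hconst, expIsometry_zero_apply] at hderiv
  exact hderiv.unique (hasDerivAt_const _ _)

theorem integrable_comp_smul_mul {f g : E → ℂ} {G : Set E} (hf : ContinuousOn f G)
    (hg : Continuous g) {c : ℝ} (hc : ∀ x : E, ‖x‖ = 1 → c • x ∈ G) :
    Integrable (fun θ : Metric.sphere (0 : E) 1 => f (c • (θ : E)) * g θ) volume.toSphere :=
  ((hf.comp_continuous (by fun_prop) fun θ : Metric.sphere (0 : E) 1 =>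
    hc θ (by simp)).mul (by fun_prop)).integrable_of_hasCompactSupport (.of_compactSpace _)

theorem integral_linDeriv_mul (hA : A ∈ skewAdjoint (E →L[ℝ] E)) {f g : E → ℂ} {G : Set E}
    (hG : IsOpen G) (hf : ContDiffOn ℝ 1 f G) (hg : ContDiff ℝ 1 g) {c : ℝ}
    (hc : ∀ x : E, ‖x‖ = 1 → c • x ∈ G) :
    ∫ θ : Metric.sphere (0 : E) 1, linDeriv A f (c • (θ : E)) * g θ ∂volume.toSphere =
      -∫ θ : Metric.sphere (0 : E) 1, f (c • (θ : E)) * linDeriv A g θ ∂volume.toSphere := by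
  have hopen : IsOpen ((c • ·) ⁻¹' G) := hG.preimage (continuous_const_smul c)
  have hfc : ContDiffOn ℝ 1 (fun x => f (c • x)) ((c • ·) ⁻¹' G) :=
    hf.comp (contDiff_const_smul c).contDiffOn fun _ hx => hx
  have hprod := integral_linDeriv_eq_zero hA hopen (fun x hx => hc x (by simpa using hx))
    (hfc.mul hg.contDiffOn)
  rw [eq_neg_iff_add_eq_zero, ← integral_add
    (integrable_comp_smul_mul (contDiffOn_linDeriv hG hf (m := 0) (by simp)).continuousOn
      hg.continuous hc)
    (integrable_comp_smul_mul hf.continuousOn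
      (contDiff_linDeriv hg (m := 0) (by simp)).continuous hc), ← hprod]
  refine integral_congr_ae (.of_forall fun θ => ?_)
  have hfθ := (hfc.differentiableOn one_ne_zero).differentiableAt (hopen.mem_nhds (hc θ (by simp)))
  have hgθ : DifferentiableAt ℝ g θ := hg.differentiable one_ne_zero θ
  simp only [linDeriv_mul A hfθ hgθ, linDeriv_comp_smul]

end RotationFields

section AngularLaplacian

variable {E F : Type*} [NormedAddCommGroup E] [InnerProductSpace ℝ E] [NormedAddCommGroup F]
  [NormedSpace ℝ F]

/-- The infinitesimal rotation `x ↦ ⟪u, x⟫ w - ⟪w, x⟫ u` in the plane spanned by `u` and `w`. -/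
noncomputable def planeRotation (u w : E) : E →L[ℝ] E :=
  (innerSL ℝ u).smulRight w - (innerSL ℝ w).smulRight u

theorem planeRotation_apply (u w x : E) :
    planeRotation u w x = ⟪u, x⟫_ℝ • w - ⟪w, x⟫_ℝ • u := rfl

variable {ι : Type*} [Fintype ι] (b : OrthonormalBasis ι ℝ E)

theorem sum_planeRotation_planeRotation (x : E) :
    ∑ i, ∑ j, planeRotation (b i) (b j) (planeRotation (b i) (b j) x) =
      -(2 * ((Fintype.card ι : ℝ) - 1)) • x := by
  classical
  have hx : ∑ i, ⟪b i, x⟫_ℝ • b i = x := b.sum_repr' x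
  have hterm (i j : ι) : planeRotation (b i) (b j) (planeRotation (b i) (b j) x) =
      (if i = j then (2 : ℝ) • ⟪b i, x⟫_ℝ • b i else 0) - ⟪b j, x⟫_ℝ • b j -
        ⟪b i, x⟫_ℝ • b i := by
    rcases eq_or_ne i j with rfl | hij
    · simp [planeRotation_apply, two_smul]
    · simp [planeRotation_apply, inner_sub_right, inner_smul_right, b.inner_eq_ite, hij, hij.symm]
  simp only [hterm, Finset.sum_sub_distrib, Finset.sum_ite_eq, Finset.mem_univ, if_true,
    Finset.sum_const, Finset.card_univ, ← Finset.smul_sum, hx]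
  module

theorem sum_bilin_planeRotation (B : E →L[ℝ] E →L[ℝ] F) (x : E) :
    ∑ i, ∑ j, B (planeRotation (b i) (b j) x) (planeRotation (b i) (b j) x) =
      (2 : ℝ) • (‖x‖ ^ 2 • ∑ i, B (b i) (b i) - B x x) := by
  have hdiag : ∑ i, ∑ j, ⟪b i, x⟫_ℝ ^ 2 • B (b j) (b j) = ‖x‖ ^ 2 • ∑ i, B (b i) (b i) := by
    simp_rw [← Finset.smul_sum, ← Finset.sum_smul, b.sum_sq_inner_right]
  have hcross : ∑ i, ∑ j, (⟪b i, x⟫_ℝ * ⟪b j, x⟫_ℝ) • B (b i) (b j) = B x x := by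
    conv_rhs => rw [← b.sum_repr' x]
    simp only [map_sum, map_smul, sum_apply, smul_apply,
      smul_smul, Finset.smul_sum]
    rw [Finset.sum_comm]
    simp only [mul_comm]
  have hterm (i j : ι) : B (planeRotation (b i) (b j) x) (planeRotation (b i) (b j) x) =
      ⟪b i, x⟫_ℝ ^ 2 • B (b j) (b j) + ⟪b j, x⟫_ℝ ^ 2 • B (b i) (b i) -
        (⟪b i, x⟫_ℝ * ⟪b j, x⟫_ℝ) • B (b i) (b j) -
        (⟪b j, x⟫_ℝ * ⟪b i, x⟫_ℝ) • B (b j) (b i) := by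
    simp only [planeRotation_apply, map_sub, map_smul, sub_apply,
      smul_apply]
    module
  simp only [hterm, Finset.sum_sub_distrib, Finset.sum_add_distrib]
  rw [Finset.sum_comm (f := fun i j => ⟪b j, x⟫_ℝ ^ 2 • B (b i) (b i)),
    Finset.sum_comm (f := fun i j => (⟪b j, x⟫_ℝ * ⟪b i, x⟫_ℝ) • B (b j) (b i)), hdiag, hcross]
  module

variable [FiniteDimensional ℝ E]

theorem planeRotation_mem_skewAdjoint (u w : E) :
    planeRotation u w ∈ skewAdjoint (E →L[ℝ] E) := by
  rw [skewAdjoint.mem_iff, ContinuousLinearMap.star_eq_adjoint, eq_comm,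
    ContinuousLinearMap.eq_adjoint_iff]
  intro x y
  simp only [neg_apply, planeRotation_apply, inner_neg_left, inner_sub_left,
    inner_sub_right, inner_smul_left, inner_smul_right, real_inner_comm, conj_trivial]
  ring

theorem laplacian_eq_sum_fderiv_fderiv (f : E → F) (x : E) :
    Laplacian.laplacian f x = ∑ i, fderiv ℝ (fderiv ℝ f) x (b i) (b i) := by
  simp [InnerProductSpace.laplacian_eq_iteratedFDeriv_orthonormalBasis f b,
    iteratedFDeriv_two_apply]

theorem contDiffOn_laplacian {f : E → F} {G : Set E} {m n : WithTop ℕ∞} (hG : IsOpen G)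
    (hf : ContDiffOn ℝ n f G) (hmn : m + 1 + 1 ≤ n) :
    ContDiffOn ℝ m (Laplacian.laplacian f) G := by
  refine ContDiffOn.congr (ContDiffOn.sum (s := Finset.univ) fun i _ => ?_) fun x _ =>
    laplacian_eq_sum_fderiv_fderiv (stdOrthonormalBasis ℝ E) f x
  exact (((hf.fderiv_of_isOpen hG hmn).fderiv_of_isOpen hG le_rfl).clm_apply
    contDiffOn_const).clm_apply contDiffOn_const

theorem contDiffOn_iterate_laplacian {f : E → F} {G : Set E} (hG : IsOpen G)
    (hf : ContDiffOn ℝ ∞ f G) (p : ℕ) : ContDiffOn ℝ ∞ (Laplacian.laplacian^[p] f) G := by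
  induction p generalizing f with
  | zero => exact hf
  | succ _ ih => exact ih (contDiffOn_laplacian hG hf (by simp))

/-- The operator `½ ∑ᵢⱼ Rᵢⱼ²`, where `Rᵢⱼ` is the derivative along the infinitesimal rotation
`xᵢ ∂/∂xⱼ - xⱼ ∂/∂xᵢ`. On the unit sphere it is the Laplace-Beltrami operator, but it acts on
functions defined near the sphere. -/
noncomputable def sphericalLaplacian (f : E → F) (x : E) : F :=
  (1 / 2 : ℝ) • ∑ i, ∑ j,
    linDeriv (planeRotation (stdOrthonormalBasis ℝ E i) (stdOrthonormalBasis ℝ E j))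
      (linDeriv (planeRotation (stdOrthonormalBasis ℝ E i) (stdOrthonormalBasis ℝ E j)) f) x

theorem sphericalLaplacian_eq {f : E → F} {x : E} (hf : ContDiffAt ℝ 2 f x) :
    sphericalLaplacian f x = ‖x‖ ^ 2 • Laplacian.laplacian f x - eulerDeriv (eulerDeriv f) x -
      ((finrank ℝ E : ℝ) - 2) • eulerDeriv f x := by
  simp only [sphericalLaplacian, eulerDeriv, linDeriv_linDeriv hf, Finset.sum_add_distrib,
    ← map_sum, sum_bilin_planeRotation, sum_planeRotation_planeRotation,
    ← laplacian_eq_sum_fderiv_fderiv, ContinuousLinearMap.id_apply, map_smul, Fintype.card_fin]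
  rw [linDeriv, ContinuousLinearMap.id_apply]
  module

variable [MeasurableSpace E] [BorelSpace E]

theorem integral_sphericalLaplacian_mul {f g : E → ℂ} {G : Set E} (hG : IsOpen G)
    (hf : ContDiffOn ℝ 2 f G) (hg : ContDiff ℝ 2 g) {c : ℝ}
    (hc : ∀ x : E, ‖x‖ = 1 → c • x ∈ G) :
    ∫ θ : Metric.sphere (0 : E) 1, sphericalLaplacian f (c • (θ : E)) * g θ ∂volume.toSphere =
      ∫ θ : Metric.sphere (0 : E) 1, f (c • (θ : E)) * sphericalLaplacian g θ
        ∂volume.toSphere := by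
  have hf₁ (A : E →L[ℝ] E) : ContDiffOn ℝ 1 (linDeriv A f) G :=
    contDiffOn_linDeriv hG hf (by norm_num)
  have hg₁ (A : E →L[ℝ] E) : ContDiff ℝ 1 (linDeriv A g) := contDiff_linDeriv hg (by norm_num)
  have hfg (A : E →L[ℝ] E) := integrable_comp_smul_mul
    (contDiffOn_linDeriv (A := A) hG (hf₁ A) (m := 0) (by simp)).continuousOn hg.continuous hc
  have hfg' (A : E →L[ℝ] E) := integrable_comp_smul_mul hf.continuousOn
    (contDiff_linDeriv (A := A) (hg₁ A) (m := 0) (by simp)).continuous hc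
  have hparts {A : E →L[ℝ] E} (hA : A ∈ skewAdjoint (E →L[ℝ] E)) :
      ∫ θ : Metric.sphere (0 : E) 1, linDeriv A (linDeriv A f) (c • (θ : E)) * g θ
        ∂volume.toSphere =
      ∫ θ : Metric.sphere (0 : E) 1, f (c • (θ : E)) * linDeriv A (linDeriv A g) θ
        ∂volume.toSphere := by
    rw [integral_linDeriv_mul hA hG (hf₁ A) (hg.of_le one_le_two) hc,
      integral_linDeriv_mul hA hG (hf.of_le one_le_two) (hg₁ A) hc, neg_neg]
  simp only [sphericalLaplacian, smul_mul_assoc, mul_smul_comm, Finset.sum_mul, Finset.mul_sum,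
    integral_smul]
  congr 1
  rw [integral_finsetSum _ fun i _ => integrable_finsetSum _ fun j _ => hfg _,
    integral_finsetSum _ fun i _ => integrable_finsetSum _ fun j _ => hfg' _]
  refine Finset.sum_congr rfl fun i _ => ?_
  rw [integral_finsetSum _ fun j _ => hfg _, integral_finsetSum _ fun j _ => hfg' _]
  exact Finset.sum_congr rfl fun j _ => hparts (planeRotation_mem_skewAdjoint _ _)

end AngularLaplacian

section SphericalHarmonics

variable {E : Type*} [NormedAddCommGroup E] [InnerProductSpace ℝ E] [FiniteDimensional ℝ E]

/-- `g` restricts to a spherical harmonic of degree `k` on the unit sphere. This is expressed by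
the eigenvalue equation, so it allows real `k`, and `g` itself need not be a harmonic or
homogeneous function. -/
structure IsSphericalHarmonic (k : ℝ) (g : E → ℂ) : Prop where
  contDiff : ContDiff ℝ 2 g
  sphericalLaplacian_eq : ∀ θ, ‖θ‖ = 1 →
    sphericalLaplacian g θ = -(k * (k + finrank ℝ E - 2)) • g θ

theorem isSphericalHarmonic_of_eulerDeriv {k : ℝ} {g : E → ℂ} (hg : ContDiff ℝ 2 g)
    (heuler : eulerDeriv g = k • g) (hlap : Laplacian.laplacian g = 0) :
    IsSphericalHarmonic k g := by
  refine ⟨hg, fun θ _ => ?_⟩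
  have heuler₂ : eulerDeriv (eulerDeriv g) θ = k • k • g θ := by
    have hsmul := fderiv_const_smul (hg.differentiable two_ne_zero θ) k
    simp only [heuler, eulerDeriv, linDeriv, hsmul, smul_apply]
    exact congrArg (k • ·) (congrFun heuler θ)
  rw [sphericalLaplacian_eq hg.contDiffAt, heuler₂, heuler, hlap, Pi.zero_apply, Pi.smul_apply]
  module

variable {d : ℕ}

theorem hasFDerivAt_polyVal (P : MvPolynomial (Fin d) ℂ) (x : EuclideanSpace ℝ (Fin d)) :
    HasFDerivAt (polyVal P) (∑ i, polyVal (MvPolynomial.pderiv i P) x •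
      (Complex.ofRealCLM ∘L (EuclideanSpace.proj i : EuclideanSpace ℝ (Fin d) →L[ℝ] ℝ))) x := by
  unfold polyVal
  induction P using MvPolynomial.induction_on with
  | C a => simpa using (hasFDerivAt_const (𝕜 := ℝ) a x).congr_fderiv (by ext v; simp)
  | add P Q hP hQ =>
    simp only [map_add]
    refine (hP.fun_add hQ).congr_fderiv ?_
    ext v
    simp [add_mul, Finset.sum_add_distrib]
  | mul_X P n hP =>
    have hX : HasFDerivAt (fun y : EuclideanSpace ℝ (Fin d) => (y n : ℂ)) _ x :=
      (Complex.ofRealCLM ∘L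
        (EuclideanSpace.proj n : EuclideanSpace ℝ (Fin d) →L[ℝ] ℝ)).hasFDerivAt
    simp only [map_mul, MvPolynomial.eval_X]
    refine (hP.fun_mul hX).congr_fderiv ?_
    ext v
    simp [MvPolynomial.pderiv_X, Pi.single_apply, apply_ite, add_mul, Finset.sum_add_distrib,
      Finset.mul_sum, mul_assoc]

theorem contDiff_polyVal (P : MvPolynomial (Fin d) ℂ) {n : WithTop ℕ∞} :
    ContDiff ℝ n (polyVal P : EuclideanSpace ℝ (Fin d) → ℂ) := by
  unfold polyVal
  simp only [MvPolynomial.eval_eq]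
  have hcoord (i : Fin d) : ContDiff ℝ n fun x : EuclideanSpace ℝ (Fin d) => (x i : ℂ) :=
    (Complex.ofRealCLM ∘L EuclideanSpace.proj i).contDiff
  fun_prop

theorem laplacian_polyVal (P : MvPolynomial (Fin d) ℂ) :
    Laplacian.laplacian (polyVal P : EuclideanSpace ℝ (Fin d) → ℂ) =
      polyVal (polyLaplacian d P) := by
  funext x
  have hsum : polyVal (polyLaplacian d P) x =
      ∑ i, polyVal (MvPolynomial.pderiv i (MvPolynomial.pderiv i P)) x := by
    simp [polyVal, polyLaplacian]
  have hfderiv : fderiv ℝ (polyVal P) = _ := funext fun y => (hasFDerivAt_polyVal P y).fderiv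
  have hfderiv₂ := HasFDerivAt.fun_sum (u := Finset.univ) fun (j : Fin d) _ =>
    (hasFDerivAt_polyVal (MvPolynomial.pderiv j P) x).smul_const
      (Complex.ofRealCLM ∘L (EuclideanSpace.proj j : EuclideanSpace ℝ (Fin d) →L[ℝ] ℝ))
  rw [laplacian_eq_sum_fderiv_fderiv (EuclideanSpace.basisFun (Fin d) ℝ), hfderiv, hfderiv₂.fderiv,
    hsum]
  simp [apply_ite Complex.ofReal]

theorem eulerDeriv_polyVal {P : MvPolynomial (Fin d) ℂ} {k : ℕ} (hP : P.IsHomogeneous k)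
    (x : EuclideanSpace ℝ (Fin d)) : eulerDeriv (polyVal P) x = k * polyVal P x := by
  have h := congrArg (polyVal · x) hP.sum_X_mul_pderiv
  simp only [polyVal, map_sum, map_mul, MvPolynomial.eval_X, nsmul_eq_mul, map_natCast] at h
  simp [linDeriv, (hasFDerivAt_polyVal P x).fderiv, polyVal, ← h, mul_comm]

theorem isSphericalHarmonic_conj_polyVal {k : ℕ} {P : MvPolynomial (Fin d) ℂ}
    (hP : P ∈ harmonicPolys d k) :
    IsSphericalHarmonic (k : ℝ) fun x : EuclideanSpace ℝ (Fin d) => conj (polyVal P x) := by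
  refine isSphericalHarmonic_of_eulerDeriv
    (Complex.conjCLE.contDiff.comp (contDiff_polyVal P)) ?_ ?_
  · funext x
    have hconj : HasFDerivAt (fun x => conj (polyVal P x)) _ x :=
      Complex.conjCLE.hasFDerivAt.comp x
        ((contDiff_polyVal P).differentiable one_ne_zero x).hasFDerivAt
    have heuler : fderiv ℝ (polyVal P) x x = k * polyVal P x := eulerDeriv_polyVal hP.1 x
    simp [linDeriv, hconj.fderiv, heuler]
  · have hlap : polyLaplacian d P = 0 := hP.2
    have hconj := InnerProductSpace.laplacian_CLE_comp_left (l := Complex.conjCLE)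
      (f := (polyVal P : EuclideanSpace ℝ (Fin d) → ℂ))
    rw [laplacian_polyVal, hlap] at hconj
    refine hconj.trans (funext fun x => ?_)
    simp [polyVal]

end SphericalHarmonics

section RadialCoefficients

variable {E : Type*} [NormedAddCommGroup E] [InnerProductSpace ℝ E] [FiniteDimensional ℝ E]
  {G : Set E}

/-- The logarithms of the radii `r` for which the sphere of radius `r` is contained in `G`. -/
def logRadii (G : Set E) : Set ℝ :=
  {v | ∀ x : E, ‖x‖ = 1 → Real.exp v • x ∈ G}

theorem isOpen_logRadii (hG : IsOpen G) : IsOpen (logRadii G) := by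
  refine isOpen_iff_eventually.2 fun v hv => ?_
  have hnear := (isCompact_sphere (0 : E) 1).eventually_forall_of_forall_eventually (x₀ := v)
    (P := fun w x => Real.exp w • x ∈ G) fun x hx =>
      (by fun_prop : ContinuousAt (fun p : ℝ × E => Real.exp p.1 • p.2) (v, x)).eventually_mem
        (hG.mem_nhds (hv x (by simpa using hx)))
  filter_upwards [hnear] with w hw x hx using hw x (by simpa using hx)

variable [MeasurableSpace E] [BorelSpace E] {g h f : E → ℂ}

/-- The integral of `h`, weighted by `g`, over the sphere of radius `e^v`, as a function of `v`. -/
noncomputable def radialCoeff (g h : E → ℂ) (v : ℝ) : ℂ :=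
  ∫ θ : Metric.sphere (0 : E) 1, h (Real.exp v • (θ : E)) * g θ ∂volume.toSphere

/-- The function `(d/dv - k) (radialCoeff g h)`. With `radialCoeff g h` itself it satisfies a
first order system in which `k` need not be differentiated. -/
noncomputable def shiftedRadialCoeff (k : ℝ) (g h : E → ℂ) (v : ℝ) : ℂ :=
  radialCoeff g (eulerDeriv h) v - k • radialCoeff g h v

theorem norm_radialCoeff_le (hg : Continuous g) {v M : ℝ}
    (hM : ∀ x : E, ‖x‖ = 1 → ‖h (Real.exp v • x)‖ ≤ M) :
    ‖radialCoeff g h v‖ ≤ M * ∫ θ : Metric.sphere (0 : E) 1, ‖g θ‖ ∂volume.toSphere := by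
  have hint : Integrable (fun θ : Metric.sphere (0 : E) 1 => M * ‖g θ‖) volume.toSphere :=
    Continuous.integrable_of_hasCompactSupport (by fun_prop) (.of_compactSpace _)
  rw [← integral_const_mul]
  refine norm_integral_le_of_norm_le hint (.of_forall fun θ => ?_)
  rw [norm_mul]
  exact mul_le_mul_of_nonneg_right (hM θ (by simp)) (norm_nonneg _)

theorem hasDerivAt_radialCoeff_eulerDeriv (hG : IsOpen G) (hg : Continuous g)
    (hh : ContDiffOn ℝ 1 h G) {v : ℝ} (hv : v ∈ logRadii G) :
    HasDerivAt (radialCoeff g h) (radialCoeff g (eulerDeriv h) v) v := by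
  have hcont {u : E → ℂ} (hu : ContinuousOn u G) : ContinuousOn (Function.uncurry
      fun (t : ℝ) (θ : Metric.sphere (0 : E) 1) => u (Real.exp t • (θ : E)) * g θ)
      (logRadii G ×ˢ univ) :=
    (hu.comp (f := fun p : ℝ × Metric.sphere (0 : E) 1 => Real.exp p.1 • (p.2 : E))
      (by fun_prop) fun p hp => hp.1 _ (by simp)).mul (by fun_prop)
  refine hasDerivAt_integral_of_continuousOn_prod (volume : Measure E).toSphere
    (isOpen_logRadii hG) hv (hcont hh.continuousOn)
    (hcont (contDiffOn_linDeriv hG hh (m := 0) (by simp)).continuousOn) fun t ht θ => ?_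
  have hfderiv : HasFDerivAt h _ (Real.exp t • (θ : E)) :=
    ((hh.differentiableOn one_ne_zero).differentiableAt
      (hG.mem_nhds (ht θ (by simp)))).hasFDerivAt
  exact (hfderiv.comp_hasDerivAt t ((Real.hasDerivAt_exp t).smul_const (θ : E))).mul_const (g θ)

theorem hasDerivAt_radialCoeff (hG : IsOpen G) (hg : Continuous g) (hh : ContDiffOn ℝ 1 h G)
    (k : ℝ) {v : ℝ} (hv : v ∈ logRadii G) :
    HasDerivAt (radialCoeff g h) (shiftedRadialCoeff k g h v + k • radialCoeff g h v) v :=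
  (hasDerivAt_radialCoeff_eulerDeriv hG hg hh hv).congr_deriv (sub_add_cancel _ _).symm

theorem contDiffOn_radialCoeff (hG : IsOpen G) (hg : Continuous g) (hh : ContDiffOn ℝ ∞ h G) :
    ContDiffOn ℝ ∞ (radialCoeff g h) (logRadii G) := by
  have hderiv {u : E → ℂ} (hu : ContDiffOn ℝ ∞ u G) {v : ℝ} (hv : v ∈ logRadii G) :=
    hasDerivAt_radialCoeff_eulerDeriv hG hg (hu.of_le (mod_cast le_top)) hv
  refine contDiffOn_infty.2 fun n => ?_
  induction n generalizing h with
  | zero =>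
    exact contDiffOn_zero.2 fun v hv => (hderiv hh hv).continuousAt.continuousWithinAt
  | succ n ih =>
    push_cast
    refine (contDiffOn_succ_iff_deriv_of_isOpen (isOpen_logRadii hG)).2
      ⟨fun v hv => (hderiv hh hv).differentiableAt.differentiableWithinAt, by simp, ?_⟩
    exact (ih (contDiffOn_linDeriv hG hh (by simp))).congr fun v hv => (hderiv hh hv).deriv

theorem radialCoeff_sphericalLaplacian (hG : IsOpen G) (hg : Continuous g)
    (hf : ContDiffOn ℝ 2 f G) {v : ℝ} (hv : v ∈ logRadii G) :
    radialCoeff g (sphericalLaplacian f) v =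
      Real.exp (2 * v) • radialCoeff g (Laplacian.laplacian f) v -
        radialCoeff g (eulerDeriv (eulerDeriv f)) v -
        ((finrank ℝ E : ℝ) - 2) • radialCoeff g (eulerDeriv f) v := by
  have hf₁ : ContDiffOn ℝ 1 (eulerDeriv f) G := contDiffOn_linDeriv hG hf (by norm_num)
  have hf₂ : ContDiffOn ℝ 0 (eulerDeriv (eulerDeriv f)) G := contDiffOn_linDeriv hG hf₁ (by simp)
  have hlap := (integrable_comp_smul_mul (contDiffOn_laplacian hG hf (m := 0)
    (by norm_num)).continuousOn hg hv).fun_smul (Real.exp (2 * v))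
  have heuler := (integrable_comp_smul_mul hf₁.continuousOn hg hv).fun_smul ((finrank ℝ E : ℝ) - 2)
  have heuler₂ := integrable_comp_smul_mul hf₂.continuousOn hg hv
  simp only [radialCoeff]
  rw [← integral_smul, ← integral_smul, ← integral_sub hlap heuler₂,
    ← integral_sub (by exact hlap.sub heuler₂) heuler]
  refine integral_congr_ae (.of_forall fun θ => ?_)
  have hnorm : ‖Real.exp v • (θ : E)‖ ^ 2 = Real.exp (2 * v) := by
    simp [norm_smul, ← Real.exp_nat_mul]
  simp only [sphericalLaplacian_eq (hf.contDiffAt (hG.mem_nhds (hv θ (by simp)))), hnorm, sub_mul,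
    smul_mul_assoc]

theorem radialCoeff_laplacian (hG : IsOpen G) {k : ℝ} (hg : IsSphericalHarmonic k g)
    (hf : ContDiffOn ℝ 2 f G) {v : ℝ} (hv : v ∈ logRadii G) :
    Real.exp (2 * v) • radialCoeff g (Laplacian.laplacian f) v =
      radialCoeff g (eulerDeriv (eulerDeriv f)) v +
        ((finrank ℝ E : ℝ) - 2) • radialCoeff g (eulerDeriv f) v -
        (k * (k + finrank ℝ E - 2)) • radialCoeff g f v := by
  have heigen : radialCoeff g (sphericalLaplacian f) v =
      -(k * (k + finrank ℝ E - 2)) • radialCoeff g f v := by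
    rw [radialCoeff, integral_sphericalLaplacian_mul hG hf hg.contDiff hv, radialCoeff,
      ← integral_smul]
    refine integral_congr_ae (.of_forall fun θ => ?_)
    simp only [hg.sphericalLaplacian_eq θ (by simp), mul_smul_comm]
  rw [radialCoeff_sphericalLaplacian hG hg.contDiff.continuous hf hv, neg_smul] at heigen
  linear_combination heigen

theorem hasDerivAt_shiftedRadialCoeff (hG : IsOpen G) {k : ℝ} (hg : IsSphericalHarmonic k g)
    (hf : ContDiffOn ℝ 2 f G) {v : ℝ} (hv : v ∈ logRadii G) :
    HasDerivAt (shiftedRadialCoeff k g f)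
      (Real.exp (2 * v) • radialCoeff g (Laplacian.laplacian f) v -
        (k + finrank ℝ E - 2) • shiftedRadialCoeff k g f v) v := by
  have hgc := hg.contDiff.continuous
  refine ((hasDerivAt_radialCoeff_eulerDeriv hG hgc (contDiffOn_linDeriv hG hf (by norm_num))
    hv).sub ((hasDerivAt_radialCoeff_eulerDeriv hG hgc (hf.of_le one_le_two)
      hv).const_smul k)).congr_deriv ?_
  rw [radialCoeff_laplacian hG hg hf hv, shiftedRadialCoeff]
  module

end RadialCoefficients

section GeneralizedDerivatives

theorem exponent_two_mul (d k p : ℕ) : exponent d k (2 * p) = k + 2 * p := by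
  simp [exponent]

theorem exponent_two_mul_add_one (d k p : ℕ) :
    exponent d k (2 * p + 1) = -(k : ℝ) - d + 2 + 2 * p := by
  simp [exponent, show (2 * p + 1) / 2 = p by omega]

theorem genDeriv_succ_eq {lam : ℕ → ℝ} {u φ ψ : ℝ → ℂ} {n : ℕ} {c μ : ℝ} {I : Set ℝ}
    (hI : IsOpen I) (hn : ∀ v ∈ I, genDeriv lam u n v = Real.exp (c * v) • φ v)
    (hφ : ∀ v ∈ I, HasDerivAt φ (ψ v + μ • φ v) v) (hlam : lam n = c + μ) :
    ∀ v ∈ I, genDeriv lam u (n + 1) v = Real.exp (c * v) • ψ v := by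
  intro v hv
  have hexp : HasDerivAt (fun v => Real.exp (c * v)) (Real.exp (c * v) * c) v := by
    simpa using ((hasDerivAt_id v).const_mul c).exp
  have heq : genDeriv lam u n =ᶠ[𝓝 v] fun v => Real.exp (c * v) • φ v :=
    eventually_of_mem (hI.mem_nhds hv) hn
  simp only [genDeriv, heq.deriv_eq, (hexp.fun_smul (hφ v hv)).deriv, hn v hv, hlam,
    ← Complex.real_smul]
  module

variable {d : ℕ} {G : Set (EuclideanSpace ℝ (Fin d))} {f g : EuclideanSpace ℝ (Fin d) → ℂ}

theorem genDeriv_radialCoeff_two_mul (hG : IsOpen G) {k : ℕ} (hg : IsSphericalHarmonic k g)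
    (hf : ContDiffOn ℝ ∞ f G) (p : ℕ) : ∀ v ∈ logRadii G,
    genDeriv (exponent d k) (radialCoeff g f) (2 * p) v =
      Real.exp (2 * p * v) • radialCoeff g (Laplacian.laplacian^[p] f) v := by
  induction p with
  | zero => simp [genDeriv]
  | succ p ih =>
    have hfp := contDiffOn_iterate_laplacian hG hf p
    have hodd := genDeriv_succ_eq (isOpen_logRadii hG) ih (fun v hv => hasDerivAt_radialCoeff hG
      hg.contDiff.continuous (hfp.of_le (by simp)) k hv) (by rw [exponent_two_mul, add_comm])
    have heven := genDeriv_succ_eq (isOpen_logRadii hG) hodd (μ := -(k + d - 2))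
      (ψ := fun v => Real.exp (2 * v) • radialCoeff g (Laplacian.laplacian^[p + 1] f) v)
      (fun v hv => (hasDerivAt_shiftedRadialCoeff hG hg
        (hfp.of_le (WithTop.coe_le_coe.2 le_top)) hv).congr_deriv (by
          simp only [Function.iterate_succ_apply', finrank_euclideanSpace_fin]; module))
      (by rw [exponent_two_mul_add_one]; ring)
    intro v hv
    rw [mul_add_one, heven v hv, smul_smul, ← Real.exp_add]
    push_cast
    ring_nf

theorem genDeriv_radialCoeff_two_mul_add_one (hG : IsOpen G) {k : ℕ}
    (hg : IsSphericalHarmonic k g) (hf : ContDiffOn ℝ ∞ f G) (p : ℕ) : ∀ v ∈ logRadii G,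
    genDeriv (exponent d k) (radialCoeff g f) (2 * p + 1) v =
      Real.exp (2 * p * v) • shiftedRadialCoeff k g (Laplacian.laplacian^[p] f) v :=
  genDeriv_succ_eq (isOpen_logRadii hG) (genDeriv_radialCoeff_two_mul hG hg hf p)
    (fun _ hv => hasDerivAt_radialCoeff hG hg.contDiff.continuous
      ((contDiffOn_iterate_laplacian hG hf p).of_le (by simp)) k hv)
    (by rw [exponent_two_mul, add_comm])

end GeneralizedDerivatives

section FirstOrderSystem

variable {F : Type*} [NormedAddCommGroup F] [NormedSpace ℝ F] {g w h : ℝ → F} {k m a b : ℝ}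

theorem hasDerivAt_exp_smul_sub_smul_sub {v : ℝ} (hg : HasDerivAt g (w v + k • g v) v)
    (hw : HasDerivAt w (h v - m • w v) v) :
    HasDerivAt (fun v => Real.exp (m * (v - b)) • ((v - a) • w v - g v))
      (Real.exp (m * (v - b)) • ((v - a) • h v - (k + m) • g v)) v := by
  have hexp : HasDerivAt (fun v => Real.exp (m * (v - b))) (Real.exp (m * (v - b)) * m) v := by
    simpa using (((hasDerivAt_id v).sub_const b).const_mul m).exp
  exact (hexp.fun_smul ((((hasDerivAt_id v).sub_const a).fun_smul hw).fun_sub hg)).congr_deriv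
    (by simp only [id]; module)

theorem norm_exp_smul_sub_smul_le {M H v : ℝ} (hk : 0 ≤ k) (hkm : k ≤ m) (hv : v ∈ Icc a b)
    (hM : ‖g v‖ ≤ M) (hH : ‖h v‖ ≤ H) :
    ‖Real.exp (m * (v - b)) • ((v - a) • h v - (k + m) • g v)‖ ≤
      (b - a) * H + 2 * M * (Real.exp (m * (v - b)) * m) := by
  have hexp : Real.exp (m * (v - b)) ≤ 1 :=
    Real.exp_le_one_iff.2 (mul_nonpos_of_nonneg_of_nonpos (hk.trans hkm) (sub_nonpos.2 hv.2))
  have hH₀ : 0 ≤ H := (norm_nonneg _).trans hH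
  have hM₀ : 0 ≤ M := (norm_nonneg _).trans hM
  have hva : 0 ≤ v - a := sub_nonneg.2 hv.1
  have hkm₀ : 0 ≤ k + m := by linarith
  calc ‖Real.exp (m * (v - b)) • ((v - a) • h v - (k + m) • g v)‖
      ≤ Real.exp (m * (v - b)) * ((v - a) * H + (k + m) * M) := by
        rw [norm_smul, Real.norm_of_nonneg (Real.exp_pos _).le]
        gcongr
        refine norm_sub_le_of_le ?_ ?_
        · rw [norm_smul, Real.norm_of_nonneg hva]; gcongr
        · rw [norm_smul, Real.norm_of_nonneg hkm₀]; gcongr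
    _ = Real.exp (m * (v - b)) * ((v - a) * H) +
          (k + m) * M * Real.exp (m * (v - b)) := by ring
    _ ≤ 1 * ((b - a) * H) + (m + m) * M * Real.exp (m * (v - b)) := by gcongr; exact hv.2
    _ = (b - a) * H + 2 * M * (Real.exp (m * (v - b)) * m) := by ring

/- The factor `exp (m * (v - b))` removes `w` from the derivative of `(v - a) • w - g`. The
remaining term `(k + m) • g` is large with `m`, but its integral against that factor is not. -/
theorem sub_mul_norm_le_of_hasDerivAt {M H : ℝ} (hk : 0 ≤ k) (hkm : k ≤ m) (hab : a ≤ b)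
    (hg : ∀ v ∈ Icc a b, HasDerivAt g (w v + k • g v) v)
    (hw : ∀ v ∈ Icc a b, HasDerivAt w (h v - m • w v) v) (hM : ∀ v ∈ Icc a b, ‖g v‖ ≤ M)
    (hH : ∀ v ∈ Icc a b, ‖h v‖ ≤ H) :
    (b - a) * ‖w b‖ ≤ 3 * M + (b - a) ^ 2 * H := by
  set Γ : ℝ → F := fun v => Real.exp (m * (v - b)) • ((v - a) • w v - g v) with hΓ
  have hΓ' {v : ℝ} (hv : v ∈ Icc a b) := (hasDerivAt_exp_smul_sub_smul_sub (a := a) (b := b)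
    (hg v hv) (hw v hv)).sub_const (Γ a)
  have hbound (v : ℝ) : HasDerivAt (fun v => (b - a) * H * (v - a) +
      2 * M * (Real.exp (m * (v - b)) - Real.exp (m * (a - b))))
      ((b - a) * H + 2 * M * (Real.exp (m * (v - b)) * m)) v := by
    simpa using (((hasDerivAt_id v).sub_const a).const_mul ((b - a) * H)).fun_add
      (((((hasDerivAt_id v).sub_const b).const_mul m).exp.sub_const _).const_mul (2 * M))
  have hincr : ‖Γ b - Γ a‖ ≤ (b - a) * H * (b - a) +
      2 * M * (Real.exp (m * (b - b)) - Real.exp (m * (a - b))) :=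
    image_norm_le_of_norm_deriv_right_le_deriv_boundary (f := fun v => Γ v - Γ a)
      (fun v hv => (hΓ' hv).continuousAt.continuousWithinAt)
      (fun v hv => (hΓ' (Ico_subset_Icc_self hv)).hasDerivWithinAt) (by simp) hbound
      (fun v hv => norm_exp_smul_sub_smul_le hk hkm (Ico_subset_Icc_self hv)
        (hM v (Ico_subset_Icc_self hv)) (hH v (Ico_subset_Icc_self hv)))
      (right_mem_Icc.2 hab)
  have hsplit : (b - a) • w b = (Γ b - Γ a) + (g b - Real.exp (m * (a - b)) • g a) := by
    have hΓa : Γ a = -(Real.exp (m * (a - b)) • g a) := by simp [hΓ]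
    have hΓb : Γ b = (b - a) • w b - g b := by simp [hΓ]
    rw [hΓa, hΓb]
    abel
  have hgb := hM b (right_mem_Icc.2 hab)
  have hga := hM a (left_mem_Icc.2 hab)
  have hM₀ : 0 ≤ M := (norm_nonneg _).trans hga
  calc (b - a) * ‖w b‖ = ‖(Γ b - Γ a) + (g b - Real.exp (m * (a - b)) • g a)‖ := by
        rw [← hsplit, norm_smul, Real.norm_of_nonneg (sub_nonneg.2 hab)]
    _ ≤ ((b - a) * H * (b - a) + 2 * M * (Real.exp (m * (b - b)) - Real.exp (m * (a - b)))) +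
          (M + Real.exp (m * (a - b)) * M) := by
        refine norm_add_le_of_le hincr (norm_sub_le_of_le hgb ?_)
        rw [norm_smul, Real.norm_of_nonneg (Real.exp_pos _).le]
        gcongr
    _ ≤ 3 * M + (b - a) ^ 2 * H := by
        rw [sub_self, mul_zero, Real.exp_zero]
        nlinarith [mul_nonneg hM₀ (Real.exp_pos (m * (a - b))).le]

end FirstOrderSystem

section Growth

theorem exists_natCast_mul_pow_le {y z : ℝ} (hy : 0 ≤ y) (hyz : y < z) :
    ∃ c : ℝ, 0 < c ∧ ∀ n : ℕ, n * y ^ n ≤ c * z ^ n := by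
  have hz : 0 < z := hy.trans_lt hyz
  have hlittle : (fun n : ℕ => (n : ℝ) ^ 1 * y ^ n) =o[atTop] fun n => z ^ n :=
    isLittleO_pow_const_mul_const_pow_const_pow_of_norm_lt 1 (by rwa [Real.norm_of_nonneg hy])
  obtain ⟨c, hc, hle⟩ := Asymptotics.bound_of_isBigO_nat_atTop hlittle.isBigO
  refine ⟨c, hc, fun n => ?_⟩
  simpa [abs_of_nonneg hy, abs_of_pos hz] using hle (pow_pos hz n).ne'

theorem exists_factorial_mul_pow_add_le {a b y z : ℝ} (ha : 0 ≤ a) (hb : 0 ≤ b) (hy : 0 ≤ y)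
    (hyz : y < z) : ∃ K : ℝ, 0 ≤ K ∧ ∀ n : ℕ,
      a * n.factorial * y ^ n + b * (n + 2).factorial * y ^ (n + 2) ≤
        K * (n + 1).factorial * z ^ (n + 1) := by
  have hz : 0 < z := hy.trans_lt hyz
  obtain ⟨c, hc, hcz⟩ := exists_natCast_mul_pow_le hy hyz
  refine ⟨a / z + b * c * z, by positivity, fun n => ?_⟩
  calc a * n.factorial * y ^ n + b * (n + 2).factorial * y ^ (n + 2)
      = a * n.factorial * y ^ n +
          b * (n + 1).factorial * (((n + 2 : ℕ) : ℝ) * y ^ (n + 2)) := by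
        rw [Nat.factorial_succ (n + 1)]; push_cast; ring
    _ ≤ a * (n + 1).factorial * z ^ n + b * (n + 1).factorial * (c * z ^ (n + 2)) := by
        gcongr a * Nat.factorial ?_ * ?_ + b * (n + 1).factorial * ?_
        · omega
        · gcongr
        · exact hcz (n + 2)
    _ = (a / z + b * c * z) * (n + 1).factorial * z ^ (n + 1) := by field_simp; ring

end Growth

section ShiftedBound

variable {E : Type*} [NormedAddCommGroup E] [InnerProductSpace ℝ E] [FiniteDimensional ℝ E]
  [MeasurableSpace E] [BorelSpace E] {G : Set E} {f g : E → ℂ}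

theorem mul_norm_shiftedRadialCoeff_le (hG : IsOpen G) {k : ℝ} (hk : 0 ≤ k)
    (hE : 2 ≤ finrank ℝ E) (hg : IsSphericalHarmonic k g) (hf : ContDiffOn ℝ 2 f G)
    {v δ M H : ℝ} (hδ : 0 ≤ δ) (hI : Icc (v - δ) v ⊆ logRadii G)
    (hM : ∀ t ∈ Icc (v - δ) v, ‖radialCoeff g f t‖ ≤ M)
    (hH : ∀ t ∈ Icc (v - δ) v, ‖radialCoeff g (Laplacian.laplacian f) t‖ ≤ H) :
    δ * ‖shiftedRadialCoeff k g f v‖ ≤ 3 * M + δ ^ 2 * (Real.exp (2 * v) * H) := by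
  have hE' : (2 : ℝ) ≤ finrank ℝ E := mod_cast hE
  have hbound := sub_mul_norm_le_of_hasDerivAt hk (by linarith) (sub_le_self v hδ)
    (fun t ht => hasDerivAt_radialCoeff hG hg.contDiff.continuous (hf.of_le one_le_two) k (hI ht))
    (fun t ht => hasDerivAt_shiftedRadialCoeff hG hg hf (hI ht)) hM
    (H := Real.exp (2 * v) * H) fun t ht => by
      rw [norm_smul, Real.norm_of_nonneg (Real.exp_pos _).le]
      gcongr
      exacts [ht.2, hH t ht]
  rwa [sub_sub_cancel] at hbound

end ShiftedBound

section Bounds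

variable {d : ℕ} {τ : ℝ} {G : Set (EuclideanSpace ℝ (Fin d))} {f : EuclideanSpace ℝ (Fin d) → ℂ}

theorem exists_norm_radialCoeff_iterate_laplacian_le (hf : PolyharmonicOfInfiniteOrder τ G f)
    {I : Set ℝ} (hI : IsCompact I) (hIG : I ⊆ logRadii G) {ε : ℝ} (hε : 0 < ε) :
    ∃ C : ℝ, 0 < C ∧ ∀ g : EuclideanSpace ℝ (Fin d) → ℂ, Continuous g → ∀ p : ℕ, ∀ v ∈ I,
      ‖radialCoeff g (Laplacian.laplacian^[p] f) v‖ ≤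
        C * (2 * p).factorial * (τ + ε) ^ (2 * p) *
          ∫ θ : Metric.sphere (0 : EuclideanSpace ℝ (Fin d)) 1, ‖g θ‖ ∂volume.toSphere := by
  have hcompact : IsCompact ((fun q : ℝ × EuclideanSpace ℝ (Fin d) => Real.exp q.1 • q.2) ''
      (I ×ˢ Metric.sphere 0 1)) :=
    (hI.prod (isCompact_sphere _ _)).image (by fun_prop)
  obtain ⟨C, hC, hbound⟩ := hf.2 _ (by
    rintro _ ⟨⟨v, x⟩, ⟨hv, hx⟩, rfl⟩
    exact hIG hv x (by simpa using hx)) hcompact ε hε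
  exact ⟨C, hC, fun g hg p v hv => norm_radialCoeff_le hg fun x hx =>
    hbound p _ ⟨(v, x), ⟨hv, by simpa using hx⟩, rfl⟩⟩

theorem exp_two_mul_mul (p : ℕ) (v : ℝ) : Real.exp (2 * p * v) = Real.exp v ^ (2 * p) := by
  rw [← Real.exp_nat_mul]; push_cast; rfl

theorem exists_norm_genDeriv_radialCoeff_two_mul_le (hG : IsOpen G)
    (hf : PolyharmonicOfInfiniteOrder τ G f) {v : ℝ} (hv : v ∈ logRadii G) {ε : ℝ} (hε : 0 < ε) :
    ∃ C : ℝ, 0 < C ∧ ∀ (p k : ℕ) (g : EuclideanSpace ℝ (Fin d) → ℂ), IsSphericalHarmonic k g →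
      ‖genDeriv (exponent d k) (radialCoeff g f) (2 * p) v‖ ≤
        C * (2 * p).factorial * (Real.exp v * (τ + ε)) ^ (2 * p) *
          ∫ θ : Metric.sphere (0 : EuclideanSpace ℝ (Fin d)) 1, ‖g θ‖ ∂volume.toSphere := by
  obtain ⟨C, hC, hbound⟩ := exists_norm_radialCoeff_iterate_laplacian_le hf
    (isCompact_singleton (x := v)) (singleton_subset_iff.2 hv) hε
  refine ⟨C, hC, fun p k g hg => ?_⟩
  rw [genDeriv_radialCoeff_two_mul hG hg hf.1 p v hv, norm_smul,
    Real.norm_of_nonneg (Real.exp_pos _).le, exp_two_mul_mul]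
  calc Real.exp v ^ (2 * p) * ‖radialCoeff g (Laplacian.laplacian^[p] f) v‖
      ≤ Real.exp v ^ (2 * p) * (C * (2 * p).factorial * (τ + ε) ^ (2 * p) * _) := by
        gcongr; exact hbound g hg.contDiff.continuous p v rfl
    _ = _ := by rw [mul_pow]; ring

theorem exists_mul_norm_shiftedRadialCoeff_iterate_laplacian_le (hd : 2 ≤ d) (hG : IsOpen G)
    (hf : PolyharmonicOfInfiniteOrder τ G f) {v : ℝ} (hv : v ∈ logRadii G) {ε : ℝ} (hε : 0 < ε) :
    ∃ δ : ℝ, 0 < δ ∧ ∃ C : ℝ, 0 < C ∧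
      ∀ (p k : ℕ) (g : EuclideanSpace ℝ (Fin d) → ℂ), IsSphericalHarmonic k g →
        δ * ‖shiftedRadialCoeff k g (Laplacian.laplacian^[p] f) v‖ ≤
          C * (3 * (2 * p).factorial * (τ + ε) ^ (2 * p) +
            (δ * Real.exp v) ^ 2 * (2 * p + 2).factorial * (τ + ε) ^ (2 * p + 2)) *
          ∫ θ : Metric.sphere (0 : EuclideanSpace ℝ (Fin d)) 1, ‖g θ‖ ∂volume.toSphere := by
  obtain ⟨δ, hδ, hball⟩ := Metric.nhds_basis_closedBall.mem_iff.1
    ((isOpen_logRadii hG).mem_nhds hv)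
  have hI : Icc (v - δ) v ⊆ logRadii G :=
    (Icc_subset_Icc_right (by linarith)).trans (Real.closedBall_eq_Icc ▸ hball)
  obtain ⟨C, hC, hbound⟩ := exists_norm_radialCoeff_iterate_laplacian_le hf isCompact_Icc hI hε
  refine ⟨δ, hδ, C, hC, fun p k g hg => ?_⟩
  have hgc := hg.contDiff.continuous
  have hshift := mul_norm_shiftedRadialCoeff_le hG k.cast_nonneg (by simpa using hd) hg
    ((contDiffOn_iterate_laplacian hG hf.1 p).of_le (WithTop.coe_le_coe.2 le_top)) hδ.le hI
    (hbound g hgc p) fun t ht => by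
      simpa only [Function.iterate_succ_apply'] using hbound g hgc (p + 1) t ht
  have hexp : Real.exp (2 * v) = Real.exp v ^ 2 := by simpa using exp_two_mul_mul 1 v
  rw [hexp, mul_add_one] at hshift
  exact hshift.trans_eq (by ring)

theorem exists_norm_genDeriv_radialCoeff_two_mul_add_one_le (hd : 2 ≤ d) (hτ : 0 ≤ τ)
    (hG : IsOpen G) (hf : PolyharmonicOfInfiniteOrder τ G f) {v : ℝ} (hv : v ∈ logRadii G)
    {ε : ℝ} (hε : 0 < ε) :
    ∃ C : ℝ, 0 ≤ C ∧ ∀ (p k : ℕ) (g : EuclideanSpace ℝ (Fin d) → ℂ), IsSphericalHarmonic k g →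
      ‖genDeriv (exponent d k) (radialCoeff g f) (2 * p + 1) v‖ ≤
        C * (2 * p + 1).factorial * (Real.exp v * (τ + ε)) ^ (2 * p + 1) *
          ∫ θ : Metric.sphere (0 : EuclideanSpace ℝ (Fin d)) 1, ‖g θ‖ ∂volume.toSphere := by
  obtain ⟨δ, hδ, C, hC, hbound⟩ :=
    exists_mul_norm_shiftedRadialCoeff_iterate_laplacian_le hd hG hf hv (half_pos hε)
  obtain ⟨K, hK, hgrowth⟩ := exists_factorial_mul_pow_add_le (a := 3) (b := δ ^ 2)
    (y := Real.exp v * (τ + ε / 2)) (z := Real.exp v * (τ + ε)) (by norm_num) (by positivity)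
    (by positivity) (mul_lt_mul_of_pos_left (by linarith) (Real.exp_pos v))
  refine ⟨C * K / δ, by positivity, fun p k g hg => ?_⟩
  set N := ∫ θ : Metric.sphere (0 : EuclideanSpace ℝ (Fin d)) 1, ‖g θ‖ ∂volume.toSphere
  have hN : 0 ≤ N := integral_nonneg fun θ => norm_nonneg _
  rw [genDeriv_radialCoeff_two_mul_add_one hG hg hf.1 p v hv, norm_smul,
    Real.norm_of_nonneg (Real.exp_pos _).le, exp_two_mul_mul]
  refine le_of_mul_le_mul_left ?_ hδ
  calc δ * (Real.exp v ^ (2 * p) * ‖shiftedRadialCoeff k g (Laplacian.laplacian^[p] f) v‖)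
      = Real.exp v ^ (2 * p) * (δ * ‖shiftedRadialCoeff k g (Laplacian.laplacian^[p] f) v‖) :=
        mul_left_comm _ _ _
    _ ≤ Real.exp v ^ (2 * p) * (C * (3 * (2 * p).factorial * (τ + ε / 2) ^ (2 * p) +
          (δ * Real.exp v) ^ 2 * (2 * p + 2).factorial * (τ + ε / 2) ^ (2 * p + 2)) * N) :=
        mul_le_mul_of_nonneg_left (hbound p k g hg) (by positivity)
    _ = C * (3 * (2 * p).factorial * (Real.exp v * (τ + ε / 2)) ^ (2 * p) +
          δ ^ 2 * (2 * p + 2).factorial * (Real.exp v * (τ + ε / 2)) ^ (2 * p + 2)) * N := by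
        rw [mul_pow (Real.exp v), mul_pow (Real.exp v)]
        ring
    _ ≤ C * (K * (2 * p + 1).factorial * (Real.exp v * (τ + ε)) ^ (2 * p + 1)) * N :=
        mul_le_mul_of_nonneg_right (mul_le_mul_of_nonneg_left (hgrowth (2 * p)) hC.le) hN
    _ = _ := by field_simp

theorem exists_norm_genDeriv_radialCoeff_le (hd : 2 ≤ d) (hτ : 0 ≤ τ) (hG : IsOpen G)
    (hf : PolyharmonicOfInfiniteOrder τ G f) {v : ℝ} (hv : v ∈ logRadii G) {ε : ℝ} (hε : 0 < ε) :
    ∃ C : ℝ, 0 < C ∧ ∀ (n k : ℕ) (g : EuclideanSpace ℝ (Fin d) → ℂ), IsSphericalHarmonic k g →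
      ‖genDeriv (exponent d k) (radialCoeff g f) n v‖ ≤
        C * n.factorial * (Real.exp v * (τ + ε)) ^ n *
          ∫ θ : Metric.sphere (0 : EuclideanSpace ℝ (Fin d)) 1, ‖g θ‖ ∂volume.toSphere := by
  obtain ⟨A, hA, heven⟩ := exists_norm_genDeriv_radialCoeff_two_mul_le hG hf hv hε
  obtain ⟨B, hB, hodd⟩ := exists_norm_genDeriv_radialCoeff_two_mul_add_one_le hd hτ hG hf hv hε
  refine ⟨A + B, by positivity, fun n k g hg => ?_⟩
  have hN : 0 ≤ ∫ θ : Metric.sphere (0 : EuclideanSpace ℝ (Fin d)) 1, ‖g θ‖ ∂volume.toSphere :=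
    integral_nonneg fun θ => norm_nonneg _
  obtain ⟨p, rfl | rfl⟩ := n.even_or_odd'
  · refine (heven p k g hg).trans (mul_le_mul_of_nonneg_right ?_ hN)
    gcongr
    linarith
  · refine (hodd p k g hg).trans (mul_le_mul_of_nonneg_right ?_ hN)
    gcongr
    linarith

theorem integral_norm_polyVal_le {P : MvPolynomial (Fin d) ℂ}
    (hP : sphereInner (polyVal P : EuclideanSpace ℝ (Fin d) → ℂ) (polyVal P) = 1) :
    ∫ θ : Metric.sphere (0 : EuclideanSpace ℝ (Fin d)) 1, ‖polyVal P θ‖ ∂sphereMeasure d ≤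
      ((sphereMeasure d).real univ + 1) / 2 := by
  have hcont : Continuous (polyVal P : EuclideanSpace ℝ (Fin d) → ℂ) :=
    (contDiff_polyVal P (n := 0)).continuous
  have hint {u : Metric.sphere (0 : EuclideanSpace ℝ (Fin d)) 1 → ℝ} (hu : Continuous u) :
      Integrable u (sphereMeasure d) :=
    Continuous.integrable_of_hasCompactSupport (μ := volume.toSphere) hu (.of_compactSpace _)
  have hsq : ∫ θ : Metric.sphere (0 : EuclideanSpace ℝ (Fin d)) 1, ‖polyVal P θ‖ ^ 2
      ∂sphereMeasure d = 1 := by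
    simp only [sphereInner, Complex.mul_conj'] at hP
    exact_mod_cast hP
  calc ∫ θ : Metric.sphere (0 : EuclideanSpace ℝ (Fin d)) 1, ‖polyVal P θ‖ ∂sphereMeasure d
      ≤ ∫ θ : Metric.sphere (0 : EuclideanSpace ℝ (Fin d)) 1, (1 + ‖polyVal P θ‖ ^ 2) / 2
          ∂sphereMeasure d :=
        integral_mono (hint (by fun_prop)) (hint (by fun_prop)) fun θ => by
          nlinarith [sq_nonneg (‖polyVal P (θ : EuclideanSpace ℝ (Fin d))‖ - 1)]
    _ = ((sphereMeasure d).real univ + 1) / 2 := by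
        rw [integral_div, integral_add (hint continuous_const) (hint (by fun_prop)), hsq]
        simp

theorem logFourierLaplaceCoeff_eq_radialCoeff (B : SphericalHarmonicBasis d) (k : ℕ)
    (l : Fin (harmonicDim d k)) : logFourierLaplaceCoeff B f k l =
      radialCoeff (fun x => conj (polyVal (B.Y k l : MvPolynomial (Fin d) ℂ) x)) f :=
  rfl

end Bounds

section Annulus

variable {d : ℕ} {r₀ r₁ : ℝ≥0∞}

theorem isOpen_annulus : IsOpen (annulus d r₀ r₁) := by
  have hcont : Continuous fun x : EuclideanSpace ℝ (Fin d) => ENNReal.ofReal ‖x‖ :=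
    ENNReal.continuous_ofReal.comp continuous_norm
  exact (isOpen_lt continuous_const hcont).inter (isOpen_lt hcont continuous_const)

theorem logInterval_subset_logRadii_annulus : logInterval r₀ r₁ ⊆ logRadii (annulus d r₀ r₁) := by
  intro v hv x hx
  have hlog : (v : EReal) = ENNReal.log (ENNReal.ofReal (Real.exp v)) := by
    rw [ENNReal.log_ofReal_of_pos (Real.exp_pos v), Real.log_exp]
  simp only [logInterval, mem_ofPred_eq, hlog, ENNReal.log_lt_log_iff] at hv
  simpa only [annulus, mem_ofPred_eq, norm_smul, hx, mul_one, Real.norm_of_nonneg,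
    (Real.exp_pos v).le] using hv

end Annulus

theorem mainTheorem7_general {d : ℕ} (hd : 2 ≤ d) {G : Set (EuclideanSpace ℝ (Fin d))}
    (hG : IsOpen G) (B : SphericalHarmonicBasis d) {τ : ℝ} (hτ : 0 ≤ τ)
    {f : EuclideanSpace ℝ (Fin d) → ℂ} (hf : PolyharmonicOfInfiniteOrder τ G f) :
    (∀ (k : ℕ) (l : Fin (harmonicDim d k)),
      ContDiffOn ℝ ∞ (logFourierLaplaceCoeff B f k l) (logRadii G)) ∧
    ∀ v₀ ∈ logRadii G, ∀ ε : ℝ, 0 < ε → ∃ C : ℝ, 0 < C ∧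
      ∀ (n k : ℕ) (l : Fin (harmonicDim d k)),
        ‖genDeriv (exponent d k) (logFourierLaplaceCoeff B f k l) n v₀‖ ≤
          C * n.factorial * (Real.exp v₀ * (τ + ε)) ^ n := by
  have hharm (k : ℕ) (l : Fin (harmonicDim d k)) := isSphericalHarmonic_conj_polyVal (B.Y k l).2
  refine ⟨fun k l => contDiffOn_radialCoeff hG (hharm k l).contDiff.continuous hf.1,
    fun v₀ hv₀ ε hε => ?_⟩
  obtain ⟨C, hC, hbound⟩ := exists_norm_genDeriv_radialCoeff_le hd hτ hG hf hv₀ hε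
  refine ⟨C * (((sphereMeasure d).real univ + 1) / 2), by positivity, fun n k l => ?_⟩
  have hN := integral_norm_polyVal_le ((B.orthonormal k l l).trans (if_pos rfl))
  have hcoeff := hbound n k _ (hharm k l)
  simp only [RCLike.norm_conj, ← logFourierLaplaceCoeff_eq_radialCoeff] at hcoeff
  refine (hcoeff.trans (mul_le_mul_of_nonneg_left hN (by positivity))).trans_eq ?_
  ring

theorem mainTheorem7 (d : ℕ) (hd : 2 ≤ d) (r₀ r₁ : ℝ≥0∞) (hr : r₀ < r₁)
    (B : SphericalHarmonicBasis d) (τ : ℝ) (hτ : 0 ≤ τ)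
    (f : EuclideanSpace ℝ (Fin d) → ℂ)
    (hf : PolyharmonicOfInfiniteOrder τ (annulus d r₀ r₁) f) :
    (∀ (k : ℕ) (l : Fin (harmonicDim d k)),
      ContDiffOn ℝ ∞ (logFourierLaplaceCoeff B f k l) (logInterval r₀ r₁)) ∧
    ∀ v₀ ∈ logInterval r₀ r₁, ∀ ε : ℝ, 0 < ε → ∃ C : ℝ, 0 < C ∧
      ∀ (n k : ℕ) (l : Fin (harmonicDim d k)),
        ‖genDeriv (exponent d k) (logFourierLaplaceCoeff B f k l) n v₀‖ ≤
          C * n.factorial * (Real.exp v₀ * (τ + ε)) ^ n := by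
  obtain ⟨hsmooth, hbound⟩ := mainTheorem7_general hd isOpen_annulus B hτ hf
  exact ⟨fun k l => (hsmooth k l).mono logInterval_subset_logRadii_annulus,
    fun v₀ hv₀ => hbound v₀ (logInterval_subset_logRadii_annulus hv₀)⟩
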